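/- Let $d\ge 1$, $t>0$, $\alpha\in(0,1)$ and $\gamma\in\mathbb{R}^d$. Let $D_{\mathbb{R}^d}[0,\infty)$ be the space of càdlàg functions $[0,\infty)\to\mathbb{R}^d$ with the Skorokhod $J_1$ topology and its Borel $\sigma$-algebra. For $x\in D_{\mathbb{R}^d}[0,\infty)$ and $\beta\in(0,1)$ define the hyperplane $\beta$-quantile $$M_{t,\beta}(x)=\inf\Big\{y\in\mathbb{R}:\ \frac1t\int_0^t \mathbf 1_{\{z\in\mathbb{R}^d:\,\gamma\cdot z\le y\}}(x_s)\,ds\ \ge\ \beta\Big\}.$$ Let $X^n$ ($n\in\mathbb{N}$) and $X$ be càdlàg $\mathbb{R}^d$-valued stochastic processes, that is, random elements of $D_{\mathbb{R}^d}[0,\infty)$, each defined on its own probability space; let $P$ be the probability measure on the space of $X$. Suppose that $X^n\Rightarrow X$, i.e. $E[f(X^n)]\to E[f(X)]$ for every bounded $f:D_{\mathbb{R}^d}[0,\infty)\to\mathbb{R}$ that is continuous in the Skorokhod topology, and that at least one of the following holds: 1. for every $\varepsilon>0$, $P\big(M_{t,\beta}(X)>M_{t,\alpha}(X)+\varepsilon\big)\to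 0$ as $\beta\downarrow\alpha$; 2. $X$ has continuous paths $P$-almost surely. Then the real random variables $M_{t,\alpha}(X^n)$ converge weakly (in distribution) to $M_{t,\alpha}(X)$ as $n\to\infty$. -/

import Mathlib

open MeasureTheory Filter Topology Set
open scoped NNReal

/-- A path `x : [0, ∞) → ℝ^d` is càdlàg: right-continuous with left limits.
(At time `0` the filter `𝓝[<] 0` on `ℝ≥0` is trivial, so nothing is asked on the left there.) -/
structure IsCadlagPath {d : ℕ} (x : ℝ≥0 → EuclideanSpace ℝ (Fin d)) : Prop where
  right_continuous : ∀ s, ContinuousWithinAt x (Ici s) s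
  left_limits : ∀ s, ∃ l, Tendsto x (𝓝[<] s) (𝓝 l)

/-- The Skorokhod space `D_{ℝ^d}[0, ∞)` of càdlàg functions `[0, ∞) → ℝ^d`. -/
structure SkorokhodSpace (d : ℕ) where
  toFun : ℝ≥0 → EuclideanSpace ℝ (Fin d)
  isCadlag : IsCadlagPath toFun

namespace SkorokhodSpace

variable {d : ℕ}

instance : CoeFun (SkorokhodSpace d) (fun _ => ℝ≥0 → EuclideanSpace ℝ (Fin d)) := ⟨toFun⟩

/-- Convergence of a sequence `u n → x` in the sense of Skorokhod (J1): there are time changes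
`Λ n` with `sup_s |Λ n s - s| → 0` and `sup_{s ≤ N} ‖u n (Λ n s) - x s‖ → 0` for every `N`.
A time change is a continuous strictly increasing function `[0, ∞) → [0, ∞)` which vanishes at `0`
and tends to `∞`; these functions are exactly the order automorphisms of `[0, ∞)`. -/
def J1Converges (u : ℕ → SkorokhodSpace d) (x : SkorokhodSpace d) : Prop :=
  ∃ Λ : ℕ → (ℝ≥0 ≃o ℝ≥0),
    TendstoUniformly (fun n s => Λ n s) (fun s => s) atTop ∧
      ∀ N : ℕ, TendstoUniformlyOn (fun n s => u n (Λ n s)) x atTop (Iic (N : ℝ≥0))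

/-- The Skorokhod J1 topology, as induced by its convergent sequences: a set is open iff every
sequence which J1-converges to one of its points is eventually in it. Since J1 convergence is the
sequential convergence of a metric, these are exactly the open sets of that metric. -/
instance : TopologicalSpace (SkorokhodSpace d) where
  IsOpen U := ∀ x ∈ U, ∀ u : ℕ → SkorokhodSpace d, J1Converges u x → ∀ᶠ n in atTop, u n ∈ U
  isOpen_univ := fun _ _ _ _ => Eventually.of_forall fun _ => mem_univ _
  isOpen_inter := fun _ _ hU hV x hx u hu => (hU x hx.1 u hu).and (hV x hx.2 u hu)
  isOpen_sUnion := fun _ hS x hx u hu => by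
    obtain ⟨U, hUS, hxU⟩ := hx
    exact (hS U hUS x hxU u hu).mono fun n hn => ⟨U, hUS, hn⟩

/-- The Skorokhod space carries its Borel `σ`-algebra. -/
instance : MeasurableSpace (SkorokhodSpace d) := borel _

instance : BorelSpace (SkorokhodSpace d) := ⟨rfl⟩

/-- The fraction of the time interval `[0, t]` that the path `x` spends in the half-space
`{z | γ · z ≤ y}`, i.e. `(1 / t) ∫_0^t 1_{γ · z ≤ y}(x_s) ds`. -/
noncomputable def occupationFraction (γ : EuclideanSpace ℝ (Fin d)) (t : ℝ)
    (x : SkorokhodSpace d) (y : ℝ) : ℝ :=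
  1 / t * ∫ s in (0 : ℝ)..t,
    indicator {z : EuclideanSpace ℝ (Fin d) | inner ℝ γ z ≤ y} (fun _ => (1 : ℝ)) (x s.toNNReal)

/-- The hyperplane `α`-quantile
`M_{t,α}(x) = inf {y | (1 / t) ∫_0^t 1_{γ · z ≤ y}(x_s) ds ≥ α}`. -/
noncomputable def quantile (γ : EuclideanSpace ℝ (Fin d)) (t α : ℝ) (x : SkorokhodSpace d) : ℝ :=
  sInf {y : ℝ | α ≤ occupationFraction γ t x y}

end SkorokhodSpace

/-! The quantile is not J1-continuous, so the continuous mapping theorem cannot be applied to it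
directly. Instead, `quantile_le_iff` turns "quantile at most `y`" into "occupation fraction at `y`
at least `α`". The occupation fraction is trapped between time averages of continuous ramps, at the
price of moving `y` slightly. These averages are J1-continuous (`continuous_pathAverage`), because a
J1-convergent sequence converges at every continuity point of its limit, hence at almost every time.
They therefore converge in distribution, and the portmanteau inequalities apply to them.

The closed half-line `[α, ∞)` bounds the limsup of the distribution functions with no further
assumption. The liminf needs the open half-line `(α, ∞)`, hence an occupation fraction strictly
above `α` beyond the quantile of the limit. Each of the two alternative hypotheses supplies this
almost surely, excluding a level stretch of the fraction at height `α`. The small shifts in `y` are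
absorbed at continuity points of the limiting distribution function. -/

/-! ### Convergence of laws on the line from inequalities between distribution functions -/

/-- A sequence of probability measures on `ℝ` converges weakly as soon as its distribution functions
are asymptotically squeezed by the distribution function of the limit. -/
theorem tendsto_probabilityMeasure_of_Iic {μ : ℕ → ProbabilityMeasure ℝ} {ν : ProbabilityMeasure ℝ}
    (hup : ∀ y y' : ℝ, y < y' →
      limsup (fun n => (μ n : Measure ℝ) (Iic y)) atTop ≤ (ν : Measure ℝ) (Iic y'))
    (hlow : ∀ y y' : ℝ, y < y' →
      (ν : Measure ℝ) (Iic y) ≤ liminf (fun n => (μ n : Measure ℝ) (Iic y')) atTop) :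
    Tendsto μ atTop (𝓝 ν) := by
  set F : ℝ → ENNReal := fun y => (ν : Measure ℝ) (Iic y) with hF
  have hFmono : Monotone F := fun a b hab => measure_mono (Iic_subset_Iic.2 hab)
  have hdense : Dense {c | ContinuousAt F c} := by
    have := (hFmono.countable_not_continuousAt).dense_compl ℝ
    simpa [compl_ofPred] using this
  have hpt : ∀ c, ContinuousAt F c →
      Tendsto (fun n => (μ n : Measure ℝ) (Iic c)) atTop (𝓝 (F c)) := by
    intro c hc
    refine tendsto_of_le_liminf_of_limsup_le ?_ ?_
    · refine le_of_tendsto (hc.tendsto.mono_left (nhdsWithin_le_nhds (s := Iio c))) ?_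
      filter_upwards [self_mem_nhdsWithin] with y hy using hlow y c hy
    · refine ge_of_tendsto (hc.tendsto.mono_left (nhdsWithin_le_nhds (s := Ioi c))) ?_
      filter_upwards [self_mem_nhdsWithin] with y hy using hup c y hy
  -- Half-open intervals with endpoints at continuity points of `F` form a π-system and, by density,
  -- give arbitrarily small neighbourhoods of each point. Their masses converge by subtracting
  -- distribution functions.
  set S : Set (Set ℝ) := {s | ∃ a b, ContinuousAt F a ∧ ContinuousAt F b ∧ Ioc a b = s}
  refine IsPiSystem.tendsto_probabilityMeasure_of_tendsto_of_mem (S := S) ?_ ?_ ?_ ?_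
  · rintro _ ⟨a, b, ha, hb, rfl⟩ _ ⟨a', b', ha', hb', rfl⟩ -
    refine ⟨max a a', min b b', ?_, ?_, by rw [Ioc_inter_Ioc]⟩
    · rcases max_choice a a' with h | h <;> rw [h] <;> assumption
    · rcases min_choice b b' with h | h <;> rw [h] <;> assumption
  · rintro _ ⟨a, b, -, -, rfl⟩
    exact measurableSet_Ioc
  · intro u hu x hx
    obtain ⟨a₀, b₀, hxab, hab⟩ := mem_nhds_iff_exists_Ioo_subset.1 (hu.mem_nhds hx)
    obtain ⟨a, ha, haa⟩ := hdense.exists_between hxab.1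
    obtain ⟨b, hb, hbb⟩ := hdense.exists_between hxab.2
    exact ⟨Ioc a b, ⟨a, b, ha, hb, rfl⟩, Ioc_mem_nhds haa.2 hbb.1,
      fun z hz => hab ⟨haa.1.trans hz.1, hz.2.trans_lt hbb.2⟩⟩
  · rintro _ ⟨a, b, ha, hb, rfl⟩
    rcases le_or_gt b a with hab | hab
    · simp [Ioc_eq_empty_of_le hab]
    · have key : ∀ κ : ProbabilityMeasure ℝ,
          (κ : Measure ℝ) (Ioc a b) = (κ : Measure ℝ) (Iic b) - (κ : Measure ℝ) (Iic a) := by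
        intro κ
        have hset : Iic b \ Iic a = Ioc a b := by
          ext z
          simp [and_comm]
        rw [← hset,
          measure_sdiff (Iic_subset_Iic.2 hab.le) measurableSet_Iic.nullMeasurableSet
            (measure_ne_top _ _)]
      have := ENNReal.Tendsto.sub (hpt b hb) (hpt a ha) (Or.inl (measure_ne_top _ _))
      simp only [hF, ← key] at this
      exact (ENNReal.tendsto_toNNReal_iff (by simp) (by simp)).2 this

/-! ### Regularity of càdlàg paths -/

namespace IsCadlagPath

variable {d : ℕ} {x : ℝ≥0 → EuclideanSpace ℝ (Fin d)}

/-- Sample the path at the first point of the grid of mesh `1 / (n + 1)` strictly to the right of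
`s`. The sampled path factors through `ℕ`, and right continuity gives pointwise convergence. -/
theorem measurable (hx : IsCadlagPath x) : Measurable x := by
  set g : ℕ → ℝ≥0 → ℝ≥0 := fun n s => (⌊(n + 1 : ℝ≥0) * s⌋₊ + 1 : ℝ≥0) / (n + 1) with hg
  have hgt : ∀ n s, s < g n s := fun n s => by
    rw [hg, lt_div_iff₀ (by positivity), mul_comm]
    exact Nat.lt_floor_add_one _
  have hgle : ∀ n s, g n s ≤ s + 1 / ((n : ℝ≥0) + 1) := fun n s => by
    have hne : (n : ℝ≥0) + 1 ≠ 0 := by positivity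
    rw [div_le_iff₀ (by positivity), add_mul s, one_div_mul_cancel hne, mul_comm s]
    gcongr
    exact Nat.floor_le (by positivity)
  refine measurable_of_tendsto_metrizable (f := fun n s => x (g n s)) (fun n => ?_) ?_
  · have h1 : Measurable fun k : ℕ => x (((k : ℝ≥0) + 1) / (n + 1)) := measurable_from_top
    exact h1.comp (Nat.measurable_floor.comp (measurable_const.mul measurable_id))
  · rw [tendsto_pi_nhds]
    intro s
    refine (hx.right_continuous s).tendsto.comp (tendsto_nhdsWithin_iff.2 ⟨?_, ?_⟩)
    · refine tendsto_of_tendsto_of_tendsto_of_le_of_le tendsto_const_nhds ?_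
        (fun n => (hgt n s).le) (fun n => hgle n s)
      simpa using (tendsto_const_nhds (x := s)).add
        (tendsto_one_div_add_atTop_nhds_zero_nat (𝕜 := ℝ≥0))
    · exact Eventually.of_forall fun n => (hgt n s).le

/-- `D k` collects the points of oscillation at least `1 / (k + 1)`. Right continuity makes the
oscillation small just after each point, so every point of `D k` is isolated on the right in `D k`,
and such sets are countable. -/
theorem countable_not_continuousAt (hx : IsCadlagPath x) :
    {s | ¬ ContinuousAt x s}.Countable := by
  set D : ℕ → Set ℝ≥0 := fun k =>
    {s | ∀ U ∈ 𝓝 s, ∃ r ∈ U, ∃ r' ∈ U, (1 : ℝ) / (k + 1) ≤ dist (x r) (x r')} with hD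
  have hcount : ∀ k, (D k).Countable := by
    intro k
    refine (countable_setOfPred_isolated_right_within (s := D k)).mono ?_
    intro s hs
    refine ⟨hs, ?_⟩
    have hpos : (0 : ℝ) < 1 / (k + 1) / 2 := by positivity
    have h1 : ∀ᶠ r in 𝓝[>] s, dist (x r) (x s) < 1 / (k + 1) / 2 :=
      ((hx.right_continuous s).tendsto.mono_left (nhdsWithin_mono _ Ioi_subset_Ici_self)).eventually
        (Metric.ball_mem_nhds _ hpos)
    obtain ⟨u, hu, hus⟩ := (mem_nhdsGT_iff_exists_Ioo_subset).1 h1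
    rw [← empty_mem_iff_bot, mem_nhdsWithin]
    refine ⟨Iio u, isOpen_Iio, hu, ?_⟩
    rintro r ⟨hru, hrD, hsr⟩
    obtain ⟨a, ha, b, hb, hab⟩ := hrD (Ioo s u) (Ioo_mem_nhds hsr hru)
    have h2 : dist (x a) (x s) < 1 / (k + 1) / 2 := hus ha
    have h3 : dist (x b) (x s) < 1 / (k + 1) / 2 := hus hb
    linarith [dist_triangle_right (x a) (x b) (x s)]
  refine (countable_iUnion hcount).mono ?_
  intro s hs
  by_contra hcon
  simp only [mem_iUnion, not_exists] at hcon
  apply hs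
  rw [ContinuousAt, Metric.tendsto_nhds]
  intro ε hε
  obtain ⟨k, hk⟩ := exists_nat_one_div_lt hε
  have := hcon k
  simp only [hD, mem_ofPred_eq, not_forall, not_exists, not_and, not_le] at this
  obtain ⟨U, hU, h⟩ := this
  filter_upwards [hU] with r hr
  exact (h r hr s (mem_of_mem_nhds hU)).trans hk

end IsCadlagPath

namespace SkorokhodSpace

variable {d : ℕ}

/-- Write `u n s` as `u n (Λ n r)` with `r = (Λ n).symm s`. Then `r → s`, uniform closeness on a
bounded interval compares this value with `x r`, and continuity at `s` concludes. -/
theorem J1Converges.tendsto_apply {u : ℕ → SkorokhodSpace d} {x : SkorokhodSpace d}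
    (h : J1Converges u x) {s : ℝ≥0} (hs : ContinuousAt x s) :
    Tendsto (fun n => u n s) atTop (𝓝 (x s)) := by
  obtain ⟨Λ, hΛ, hu⟩ := h
  have hr : Tendsto (fun n => (Λ n).symm s) atTop (𝓝 s) := by
    rw [Metric.tendsto_nhds]
    intro ε hε
    filter_upwards [Metric.tendstoUniformly_iff.1 hΛ ε hε] with n hn
    simpa using hn ((Λ n).symm s)
  obtain ⟨N, hN⟩ := exists_nat_gt s
  have h1 : Tendsto (fun n => dist (x ((Λ n).symm s)) (u n s)) atTop (𝓝 0) := by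
    rw [Metric.tendsto_nhds]
    intro ε hε
    filter_upwards [Metric.tendstoUniformlyOn_iff.1 (hu N) ε hε, hr.eventually (Iio_mem_nhds hN)]
      with n hn hn'
    simpa using hn ((Λ n).symm s) (le_of_lt hn')
  exact tendsto_of_tendsto_of_dist (hs.tendsto.comp hr) h1

/-- Open sets are defined by J1-convergent sequences, so sequential continuity suffices without
first proving metrizability. -/
theorem continuous_of_J1Converges {Y : Type*} [TopologicalSpace Y] {f : SkorokhodSpace d → Y}
    (hf : ∀ u x, J1Converges u x → Tendsto (fun n => f (u n)) atTop (𝓝 (f x))) : Continuous f :=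
  ⟨fun _ hV x hx u hu => (hf u x hu).eventually (hV.mem_nhds hx)⟩

/-! ### Time averages along a path -/

/-- The time average over `[0, t]` of `φ (γ · x_s)`. -/
noncomputable def pathAverage (γ : EuclideanSpace ℝ (Fin d)) (t : ℝ) (φ : ℝ → ℝ)
    (x : SkorokhodSpace d) : ℝ :=
  1 / t * ∫ s in (0 : ℝ)..t, φ (inner ℝ γ (x s.toNNReal))

theorem occupationFraction_eq_pathAverage (γ : EuclideanSpace ℝ (Fin d)) (t : ℝ)
    (x : SkorokhodSpace d) (y : ℝ) :
    occupationFraction γ t x y = pathAverage γ t (indicator (Iic y) 1) x := rfl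

variable (γ : EuclideanSpace ℝ (Fin d)) {t : ℝ}

theorem measurable_inner_path (x : SkorokhodSpace d) :
    Measurable fun s : ℝ => inner ℝ γ (x s.toNNReal) :=
  measurable_const.inner (x.isCadlag.measurable.comp measurable_real_toNNReal)

theorem intervalIntegrable_comp_path {φ : ℝ → ℝ} (hφ : Measurable φ)
    (h01 : ∀ z, φ z ∈ Icc (0 : ℝ) 1) (x : SkorokhodSpace d) (a b : ℝ) :
    IntervalIntegrable (fun s : ℝ => φ (inner ℝ γ (x s.toNNReal))) volume a b := by
  refine (intervalIntegrable_const (c := (1 : ℝ))).mono_fun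
    (hφ.comp (measurable_inner_path γ x)).aestronglyMeasurable (Eventually.of_forall fun s => ?_)
  simpa [abs_of_nonneg (h01 _).1] using (h01 _).2

theorem pathAverage_mono (ht : 0 < t) {φ ψ : ℝ → ℝ} (hφ : Measurable φ)
    (hφ01 : ∀ z, φ z ∈ Icc (0 : ℝ) 1) (hψ : Measurable ψ) (hψ01 : ∀ z, ψ z ∈ Icc (0 : ℝ) 1)
    (h : ∀ z, φ z ≤ ψ z) (x : SkorokhodSpace d) : pathAverage γ t φ x ≤ pathAverage γ t ψ x := by
  refine mul_le_mul_of_nonneg_left ?_ (by positivity)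
  exact intervalIntegral.integral_mono ht.le (intervalIntegrable_comp_path γ hφ hφ01 x _ _)
    (intervalIntegrable_comp_path γ hψ hψ01 x _ _) fun s => h _

theorem tendsto_pathAverage {ι : Type*} {l : Filter ι} [l.IsCountablyGenerated] {φ : ι → ℝ → ℝ}
    {ψ : ℝ → ℝ} (hφ : ∀ i, Measurable (φ i)) (h01 : ∀ i z, φ i z ∈ Icc (0 : ℝ) 1)
    (h : ∀ z, Tendsto (fun i => φ i z) l (𝓝 (ψ z))) (x : SkorokhodSpace d) :
    Tendsto (fun i => pathAverage γ t (φ i) x) l (𝓝 (pathAverage γ t ψ x)) := by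
  refine Tendsto.const_mul _ ?_
  refine intervalIntegral.tendsto_integral_filter_of_dominated_convergence (fun _ => (1 : ℝ))
    (Eventually.of_forall fun i => ((hφ i).comp (measurable_inner_path γ x)).aestronglyMeasurable)
    (Eventually.of_forall fun i => Eventually.of_forall fun s _ => ?_) intervalIntegrable_const
    (Eventually.of_forall fun s _ => h _)
  simpa [abs_of_nonneg (h01 i _).1] using (h01 i _).2

theorem continuous_pathAverage (ht : 0 < t) {φ : ℝ → ℝ} (hφ : Continuous φ)
    (h01 : ∀ z, φ z ∈ Icc (0 : ℝ) 1) : Continuous (pathAverage γ t φ) := by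
  refine continuous_of_J1Converges fun u x hux => Tendsto.const_mul _ ?_
  refine intervalIntegral.tendsto_integral_filter_of_dominated_convergence (fun _ => (1 : ℝ))
    (Eventually.of_forall fun n =>
      (hφ.measurable.comp (measurable_inner_path γ (u n))).aestronglyMeasurable)
    (Eventually.of_forall fun n => Eventually.of_forall fun s _ => ?_) intervalIntegrable_const ?_
  · simpa [abs_of_nonneg (h01 _).1] using (h01 _).2
  -- The limit has only countably many discontinuities, so pointwise convergence holds at almost
  -- every time.
  · have hcount := x.isCadlag.countable_not_continuousAt.image ((↑) : ℝ≥0 → ℝ)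
    filter_upwards [hcount.ae_notMem volume] with s hs hst
    rw [uIoc_of_le ht.le] at hst
    have hc : ContinuousAt x s.toNNReal := by
      by_contra hc
      exact hs ⟨s.toNNReal, hc, Real.coe_toNNReal s hst.1.le⟩
    exact (hφ.tendsto _).comp (tendsto_const_nhds.inner (hux.tendsto_apply hc))

/-! ### Occupation fractions and quantiles -/

theorem indicator_Iic_one_mem_Icc (y z : ℝ) : indicator (Iic y) (1 : ℝ → ℝ) z ∈ Icc (0 : ℝ) 1 := by
  by_cases h : z ≤ y <;> simp [indicator, h]

theorem measurable_indicator_Iic_one (y : ℝ) : Measurable (indicator (Iic y) (1 : ℝ → ℝ)) :=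
  measurable_one.indicator measurableSet_Iic

theorem occupationFraction_mono (ht : 0 < t) (x : SkorokhodSpace d) :
    Monotone (occupationFraction γ t x) := fun y y' hy =>
  pathAverage_mono γ ht (measurable_indicator_Iic_one y) (indicator_Iic_one_mem_Icc y)
    (measurable_indicator_Iic_one y') (indicator_Iic_one_mem_Icc y')
    (indicator_le_indicator_of_subset (Iic_subset_Iic.2 hy) fun _ => zero_le_one) x

theorem tendsto_occupationFraction_nhdsGT (x : SkorokhodSpace d) (y : ℝ) :
    Tendsto (occupationFraction γ t x) (𝓝[>] y) (𝓝 (occupationFraction γ t x y)) := by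
  rw [occupationFraction_eq_pathAverage]
  refine tendsto_pathAverage γ (l := 𝓝[>] y) measurable_indicator_Iic_one
    indicator_Iic_one_mem_Icc
    (fun z => tendsto_const_nhds.congr' ?_) x
  by_cases hz : z ≤ y
  · filter_upwards [self_mem_nhdsWithin] with y' hy'
    simp [indicator, hz, hz.trans (le_of_lt hy')]
  · filter_upwards [nhdsWithin_le_nhds (Iio_mem_nhds (not_le.1 hz))] with y' hy'
    simp [indicator, hz, mem_Iio.1 hy']

theorem tendsto_occupationFraction_atTop (ht : 0 < t) (x : SkorokhodSpace d) :
    Tendsto (occupationFraction γ t x) atTop (𝓝 1) := by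
  have h : pathAverage γ t (fun _ => 1) x = 1 := by simp [pathAverage, ht.ne']
  rw [← h]
  refine tendsto_pathAverage γ (l := atTop) measurable_indicator_Iic_one
    indicator_Iic_one_mem_Icc
    (fun z => tendsto_const_nhds.congr' ?_) x
  filter_upwards [eventually_ge_atTop z] with y hy
  simp [indicator, hy]

theorem tendsto_occupationFraction_atBot (x : SkorokhodSpace d) :
    Tendsto (occupationFraction γ t x) atBot (𝓝 0) := by
  have h : pathAverage γ t (fun _ => 0) x = 0 := by simp [pathAverage]
  rw [← h]
  refine tendsto_pathAverage γ (l := atBot) measurable_indicator_Iic_one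
    indicator_Iic_one_mem_Icc
    (fun z => tendsto_const_nhds.congr' ?_) x
  filter_upwards [eventually_lt_atBot z] with y hy
  simp [indicator, hy]

/-- Right continuity of the occupation fraction in `y` makes the infimum attained. The bounds `0 < α
< 1` make the set bounded below and nonempty, so that `sInf` is a true infimum and not its default
value. -/
theorem quantile_le_iff (ht : 0 < t) {α : ℝ} (hα : α ∈ Ioo (0 : ℝ) 1) (x : SkorokhodSpace d)
    (y : ℝ) : quantile γ t α x ≤ y ↔ α ≤ occupationFraction γ t x y := by
  have hbdd : BddBelow {y : ℝ | α ≤ occupationFraction γ t x y} := by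
    obtain ⟨m, hm⟩ := ((tendsto_occupationFraction_atBot γ x).eventually_lt_const hα.1).exists
    refine ⟨m, fun z hz => le_of_not_gt fun hzm => ?_⟩
    exact (hz.trans (occupationFraction_mono γ ht x hzm.le)).not_gt hm
  have hne : {y : ℝ | α ≤ occupationFraction γ t x y}.Nonempty := by
    obtain ⟨m, hm⟩ := ((tendsto_occupationFraction_atTop γ ht x).eventually_const_lt hα.2).exists
    exact ⟨m, hm.le⟩
  refine ⟨fun h => ?_, fun h => csInf_le hbdd h⟩
  refine ge_of_tendsto (tendsto_occupationFraction_nhdsGT γ x y) ?_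
  filter_upwards [self_mem_nhdsWithin] with z hz
  obtain ⟨w, hw, hwz⟩ := exists_lt_of_csInf_lt hne (lt_of_le_of_lt h hz)
  exact le_trans hw (occupationFraction_mono γ ht x hwz.le)

/-- The continuous function equal to `1` on `(-∞, y]`, to `0` on `[y', ∞)`, and affine between. -/
noncomputable def ramp (y y' z : ℝ) : ℝ := max 0 (min 1 ((y' - z) / (y' - y)))

theorem continuous_ramp (y y' : ℝ) : Continuous (ramp y y') := by
  unfold ramp
  fun_prop

theorem ramp_mem_Icc (y y' z : ℝ) : ramp y y' z ∈ Icc (0 : ℝ) 1 :=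
  ⟨le_max_left _ _, max_le zero_le_one (min_le_left _ _)⟩

theorem indicator_Iic_one_le_ramp {y y' : ℝ} (h : y < y') (z : ℝ) :
    indicator (Iic y) 1 z ≤ ramp y y' z := by
  refine indicator_le' (fun z hz => ?_) (fun z _ => (ramp_mem_Icc y y' z).1) z
  have : 1 ≤ (y' - z) / (y' - y) := by
    rw [le_div_iff₀ (sub_pos.2 h)]
    linarith [mem_Iic.1 hz]
  simp [ramp, this]

theorem ramp_le_indicator_Iic_one {y y' : ℝ} (h : y < y') (z : ℝ) :
    ramp y y' z ≤ indicator (Iic y') 1 z := by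
  by_cases hz : z ≤ y'
  · simpa [indicator, hz] using (ramp_mem_Icc y y' z).2
  · have : (y' - z) / (y' - y) ≤ 0 := div_nonpos_of_nonpos_of_nonneg (by linarith) (by linarith)
    simp [indicator, hz, ramp, this]

theorem occupationFraction_le_pathAverage_ramp (ht : 0 < t) {y y' : ℝ} (h : y < y')
    (x : SkorokhodSpace d) : occupationFraction γ t x y ≤ pathAverage γ t (ramp y y') x :=
  pathAverage_mono γ ht (measurable_indicator_Iic_one y) (indicator_Iic_one_mem_Icc y)
    (continuous_ramp y y').measurable (ramp_mem_Icc y y') (indicator_Iic_one_le_ramp h) x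

theorem pathAverage_ramp_le_occupationFraction (ht : 0 < t) {y y' : ℝ} (h : y < y')
    (x : SkorokhodSpace d) : pathAverage γ t (ramp y y') x ≤ occupationFraction γ t x y' :=
  pathAverage_mono γ ht (continuous_ramp y y').measurable (ramp_mem_Icc y y')
    (measurable_indicator_Iic_one y') (indicator_Iic_one_mem_Icc y') (ramp_le_indicator_Iic_one h) x

/-- The indicator is discontinuous, so measurability comes from a pointwise limit of continuous ramp
averages, squeezed between the fractions at `y` and `y + 1 / (k + 1)`. -/
theorem measurable_occupationFraction (ht : 0 < t) (y : ℝ) :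
    Measurable fun x : SkorokhodSpace d => occupationFraction γ t x y := by
  have hlt : ∀ k : ℕ, y < y + 1 / ((k : ℝ) + 1) := fun k => by
    have : (0 : ℝ) < 1 / ((k : ℝ) + 1) := by positivity
    linarith
  refine measurable_of_tendsto_metrizable
    (f := fun (k : ℕ) x => pathAverage γ t (ramp y (y + 1 / ((k : ℝ) + 1))) x)
    (fun k => (continuous_pathAverage γ ht (continuous_ramp _ _) (ramp_mem_Icc _ _)).measurable) ?_
  rw [tendsto_pi_nhds]
  intro x
  have hk : Tendsto (fun k : ℕ => y + 1 / ((k : ℝ) + 1)) atTop (𝓝[>] y) := by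
    refine tendsto_nhdsWithin_iff.2 ⟨?_, Eventually.of_forall hlt⟩
    simpa using (tendsto_const_nhds (x := y)).add
      (tendsto_one_div_add_atTop_nhds_zero_nat (𝕜 := ℝ))
  exact tendsto_of_tendsto_of_tendsto_of_le_of_le tendsto_const_nhds
    ((tendsto_occupationFraction_nhdsGT γ x y).comp hk)
    (fun k => occupationFraction_le_pathAverage_ramp γ ht (hlt k) x)
    (fun k => pathAverage_ramp_le_occupationFraction γ ht (hlt k) x)

theorem measurable_quantile (ht : 0 < t) {α : ℝ} (hα : α ∈ Ioo (0 : ℝ) 1) :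
    Measurable (quantile γ t α : SkorokhodSpace d → ℝ) := by
  refine measurable_of_Iic fun y => ?_
  have : quantile γ t α ⁻¹' Iic y = {x : SkorokhodSpace d | α ≤ occupationFraction γ t x y} :=
    ext fun x => quantile_le_iff γ ht hα x y
  rw [this]
  exact measurableSet_le measurable_const (measurable_occupationFraction γ ht y)

theorem occupationFraction_eq_volume (ht : 0 < t) (x : SkorokhodSpace d) (y : ℝ) :
    occupationFraction γ t x y =
      1 / t * volume.real (Ioo 0 t ∩ {s : ℝ | inner ℝ γ (x s.toNNReal) ≤ y}) := by
  have hm : MeasurableSet {s : ℝ | inner ℝ γ (x s.toNNReal) ≤ y} :=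
    measurable_inner_path γ x measurableSet_Iic
  have : ∀ s : ℝ, indicator {z : EuclideanSpace ℝ (Fin d) | inner ℝ γ z ≤ y} (fun _ => (1 : ℝ))
      (x s.toNNReal) = indicator {s : ℝ | inner ℝ γ (x s.toNNReal) ≤ y} 1 s := fun s => rfl
  simp only [occupationFraction, this]
  rw [intervalIntegral.integral_of_le ht.le, integral_Ioc_eq_integral_Ioo,
    integral_indicator_one hm, measureReal_restrict_apply hm, inter_comm]

/-- Along a continuous path the occupation fraction exceeds `α` strictly above the
`α`-quantile. -/
theorem lt_occupationFraction_of_continuous (ht : 0 < t) {α : ℝ} (hα : α ∈ Ioo (0 : ℝ) 1)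
    {x : SkorokhodSpace d} (hx : Continuous x) {y : ℝ} (hy : quantile γ t α x < y) :
    α < occupationFraction γ t x y := by
  set m := quantile γ t α x with hm
  set f : ℝ → ℝ := fun s => inner ℝ γ (x s.toNNReal) with hf
  have hfc : Continuous f := continuous_const.inner (hx.comp continuous_real_toNNReal)
  have hαm : α ≤ occupationFraction γ t x m := (quantile_le_iff γ ht hα x m).1 le_rfl
  by_contra! hcon
  have heq : occupationFraction γ t x y = occupationFraction γ t x m :=
    le_antisymm (hcon.trans hαm) (occupationFraction_mono γ ht x hy.le)
  -- Otherwise the fraction at `m` would be `0 < α`; likewise below, if `f` never exceeded `y`, the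
  -- fraction at `y` would be `1 > α`.
  obtain ⟨a, ha, ham⟩ : ∃ a ∈ Ioo 0 t, f a ≤ m := by
    by_contra! h
    have : Ioo 0 t ∩ {s : ℝ | inner ℝ γ (x s.toNNReal) ≤ m} = ∅ :=
      eq_empty_of_forall_notMem fun s hs => (h s hs.1).not_ge hs.2
    rw [occupationFraction_eq_volume γ ht, this] at hαm
    simp only [measureReal_empty, mul_zero] at hαm
    exact hαm.not_gt hα.1
  obtain ⟨b, hb, hby⟩ : ∃ b ∈ Ioo 0 t, y < f b := by
    by_contra! h
    have : Ioo 0 t ∩ {s : ℝ | inner ℝ γ (x s.toNNReal) ≤ y} = Ioo 0 t :=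
      inter_eq_left.2 fun s hs => h s hs
    rw [occupationFraction_eq_volume γ ht, this] at hcon
    simp only [Real.volume_real_Ioo_of_le ht.le, sub_zero, one_div_mul_cancel ht.ne'] at hcon
    exact hcon.not_gt hα.2
  obtain ⟨c, hc, hcm⟩ : (m + y) / 2 ∈ f '' Ioo 0 t :=
    isPreconnected_Ioo.intermediate_value ha hb hfc.continuousOn ⟨by linarith, by linarith⟩
  -- By the intermediate value theorem this open set is nonempty. Its positive measure is time spent
  -- strictly between levels `m` and `y`, which contradicts `heq`.
  have hopen : IsOpen (Ioo 0 t ∩ f ⁻¹' Ioo m y) := isOpen_Ioo.inter (isOpen_Ioo.preimage hfc)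
  have hcmy : f c ∈ Ioo m y := by
    rw [hcm]
    constructor <;> linarith
  have hpos := hopen.measure_pos volume ⟨c, hc, hcmy⟩
  have hne : volume (Ioo 0 t ∩ f ⁻¹' Ioo m y) ≠ ⊤ :=
    measure_ne_top_of_subset inter_subset_left measure_Ioo_lt_top.ne
  have hsum : volume.real (Ioo 0 t ∩ {s : ℝ | f s ≤ m}) + volume.real (Ioo 0 t ∩ f ⁻¹' Ioo m y) ≤
      volume.real (Ioo 0 t ∩ {s : ℝ | f s ≤ y}) := by
    rw [← measureReal_union _ hopen.measurableSet
      (measure_ne_top_of_subset inter_subset_left measure_Ioo_lt_top.ne) hne]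
    · refine measureReal_mono ?_
        (measure_ne_top_of_subset inter_subset_left measure_Ioo_lt_top.ne)
      rintro s (⟨hs, hs'⟩ | ⟨hs, hs'⟩)
      · exact ⟨hs, le_trans hs' hy.le⟩
      · exact ⟨hs, hs'.2.le⟩
    · exact disjoint_left.2 fun s hs hs' => not_lt.2 hs.2 hs'.2.1
  rw [occupationFraction_eq_volume γ ht, occupationFraction_eq_volume γ ht,
    mul_right_inj' (by positivity)] at heq
  have : 0 < volume.real (Ioo 0 t ∩ f ⁻¹' Ioo m y) := ENNReal.toReal_pos hpos.ne' hne
  linarith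

/-- If the quantile is right-continuous in probability at `α`, then almost surely the occupation
fraction exceeds `α` strictly above the `α`-quantile. -/
theorem ae_lt_occupationFraction_of_tendsto (ht : 0 < t) {α : ℝ} (hα : α ∈ Ioo (0 : ℝ) 1)
    {Ω : Type*} [MeasurableSpace Ω] {P : Measure Ω} {X : Ω → SkorokhodSpace d}
    (h : ∀ ε : ℝ, 0 < ε → Tendsto
      (fun β : ℝ => P {ω | quantile γ t β (X ω) > quantile γ t α (X ω) + ε}) (𝓝[>] α) (𝓝 0)) :
    ∀ᵐ ω ∂P, ∀ y, quantile γ t α (X ω) < y → α < occupationFraction γ t (X ω) y := by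
  have hk : ∀ k : ℕ, ∀ᵐ ω ∂P, ∃ β ∈ Ioo α 1,
      quantile γ t β (X ω) ≤ quantile γ t α (X ω) + 1 / ((k : ℝ) + 1) := by
    intro k
    rw [ae_iff]
    -- The exceptional event lies in the event of `h` for every `β` in `(α, 1)`, so its measure is
    -- at most their limit `0`.
    refine le_antisymm (ge_of_tendsto (h (1 / ((k : ℝ) + 1)) (by positivity)) ?_) zero_le
    filter_upwards [Ioo_mem_nhdsGT hα.2] with β hβ
    refine measure_mono fun ω hω => ?_
    simp only [mem_ofPred_eq, not_exists, not_and, not_le] at hω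
    exact hω β hβ
  filter_upwards [ae_all_iff.2 hk] with ω hω y hy
  obtain ⟨k, hk⟩ := exists_nat_one_div_lt (sub_pos.2 hy)
  obtain ⟨β, hβ, hle⟩ := hω k
  exact hβ.1.trans_le ((quantile_le_iff γ ht ⟨hα.1.trans hβ.1, hβ.2⟩ _ _).1 (by linarith))

end SkorokhodSpace

/-! ### Open and closed half-lines along convergence in distribution -/

section HalfLines

variable {Ω : ℕ → Type*} [∀ n, MeasurableSpace (Ω n)]
  {P : (n : ℕ) → Measure (Ω n)} [∀ n, IsProbabilityMeasure (P n)]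
  {Ω' : Type*} [MeasurableSpace Ω'] {P' : Measure Ω'} [IsProbabilityMeasure P']
  {Y : (n : ℕ) → Ω n → ℝ} {Y' : Ω' → ℝ}

theorem MeasureTheory.TendstoInDistribution.limsup_measure_le
    (h : TendstoInDistribution Y atTop Y' P P') (a : ℝ) :
    limsup (fun n => P n {ω | a ≤ Y n ω}) atTop ≤ P' {ω | a ≤ Y' ω} := by
  have := ProbabilityMeasure.limsup_measure_closed_le_of_tendsto h.tendsto (isClosed_Ici (a := a))
  simpa only [ProbabilityMeasure.coe_mk, Measure.map_apply_of_aemeasurable h.aemeasurable_limit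
    measurableSet_Ici, Measure.map_apply_of_aemeasurable (h.forall_aemeasurable _)
    measurableSet_Ici] using! this

theorem MeasureTheory.TendstoInDistribution.le_liminf_measure_lt
    (h : TendstoInDistribution Y atTop Y' P P') (a : ℝ) :
    P' {ω | a < Y' ω} ≤ liminf (fun n => P n {ω | a < Y n ω}) atTop := by
  have := ProbabilityMeasure.le_liminf_measure_open_of_tendsto h.tendsto (isOpen_Ioi (a := a))
  simpa only [ProbabilityMeasure.coe_mk, Measure.map_apply_of_aemeasurable h.aemeasurable_limit
    measurableSet_Ioi, Measure.map_apply_of_aemeasurable (h.forall_aemeasurable _)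
    measurableSet_Ioi] using! this

end HalfLines

/-- If `X n ⇒ X'` in the Skorokhod space, where each process lives on its own probability space, and
the `α`-quantile of the limit is right-continuous in `α` in probability or the limit has almost
surely continuous paths, then the `α`-quantiles converge in distribution. -/
theorem mainTheorem3 {d : ℕ} {t α : ℝ} (ht : 0 < t) (hα : α ∈ Set.Ioo (0 : ℝ) 1)
    (γ : EuclideanSpace ℝ (Fin d))
    {Ω : ℕ → Type*} [∀ n, MeasurableSpace (Ω n)]
    (P : (n : ℕ) → Measure (Ω n)) [∀ n, IsProbabilityMeasure (P n)]
    {Ω' : Type*} [MeasurableSpace Ω'] (P' : Measure Ω') [IsProbabilityMeasure P']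
    (X : (n : ℕ) → Ω n → SkorokhodSpace d) (X' : Ω' → SkorokhodSpace d)
    (hX : TendstoInDistribution X atTop X' P P')
    (h : (∀ ε : ℝ, 0 < ε → Tendsto
            (fun β : ℝ => P' {ω | SkorokhodSpace.quantile γ t β (X' ω) >
              SkorokhodSpace.quantile γ t α (X' ω) + ε}) (𝓝[>] α) (𝓝 0)) ∨
         (∀ᵐ ω ∂P', Continuous (X' ω))) :
    TendstoInDistribution (fun n ω => SkorokhodSpace.quantile γ t α (X n ω)) atTop
      (fun ω => SkorokhodSpace.quantile γ t α (X' ω)) P P' := by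
  have hae : ∀ᵐ ω ∂P', ∀ y, SkorokhodSpace.quantile γ t α (X' ω) < y →
      α < SkorokhodSpace.occupationFraction γ t (X' ω) y := by
    rcases h with h | h
    · exact SkorokhodSpace.ae_lt_occupationFraction_of_tendsto γ ht hα h
    · filter_upwards [h] with ω hω y hy
      exact SkorokhodSpace.lt_occupationFraction_of_continuous γ ht hα hω hy
  have hq := SkorokhodSpace.measurable_quantile γ ht hα
  have hav : ∀ y y' : ℝ, TendstoInDistribution
      (fun n => SkorokhodSpace.pathAverage γ t (SkorokhodSpace.ramp y y') ∘ X n) atTop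
      (SkorokhodSpace.pathAverage γ t (SkorokhodSpace.ramp y y') ∘ X') P P' := fun y y' =>
    hX.continuous_comp (SkorokhodSpace.continuous_pathAverage γ ht
      (SkorokhodSpace.continuous_ramp y y') (SkorokhodSpace.ramp_mem_Icc y y'))
  refine ⟨fun n => hq.comp_aemeasurable (hX.forall_aemeasurable n),
    hq.comp_aemeasurable hX.aemeasurable_limit, ?_⟩
  have hmapn : ∀ n y, (P n).map (fun ω => SkorokhodSpace.quantile γ t α (X n ω)) (Iic y) =
      P n {ω | α ≤ SkorokhodSpace.occupationFraction γ t (X n ω) y} := fun n y => by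
    refine (Measure.map_apply_of_aemeasurable (hq.comp_aemeasurable (hX.forall_aemeasurable n))
      measurableSet_Iic).trans ?_
    exact congrArg _ (ext fun ω => SkorokhodSpace.quantile_le_iff γ ht hα _ _)
  have hmap : ∀ y, P'.map (fun ω => SkorokhodSpace.quantile γ t α (X' ω)) (Iic y) =
      P' {ω | SkorokhodSpace.quantile γ t α (X' ω) ≤ y} := fun y =>
    Measure.map_apply_of_aemeasurable (hq.comp_aemeasurable hX.aemeasurable_limit)
      measurableSet_Iic
  refine tendsto_probabilityMeasure_of_Iic (fun y y' hyy => ?_) (fun y y' hyy => ?_)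
  · simp only [ProbabilityMeasure.coe_mk, hmapn, hmap]
    refine (limsup_le_limsup (Eventually.of_forall fun n => measure_mono fun ω hω => ?_)).trans
      (((hav y y').limsup_measure_le α).trans (measure_mono fun ω hω => ?_))
    · exact le_trans hω (SkorokhodSpace.occupationFraction_le_pathAverage_ramp γ ht hyy _)
    · exact (SkorokhodSpace.quantile_le_iff γ ht hα _ _).2
        (le_trans hω (SkorokhodSpace.pathAverage_ramp_le_occupationFraction γ ht hyy _))
  · simp only [ProbabilityMeasure.coe_mk, hmapn, hmap]
    -- The gap from `y` to `m` makes the occupation fraction of the limit strictly exceed `α`; the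
    -- gap from `m` to `y'` leaves room for the ramp.
    obtain ⟨m, hym, hmy⟩ := exists_between hyy
    refine (measure_mono_ae ?_).trans (((hav m y').le_liminf_measure_lt α).trans
      (liminf_le_liminf (Eventually.of_forall fun n => measure_mono fun ω hω => ?_)))
    · filter_upwards [hae] with ω hω hle
      exact (hω m (lt_of_le_of_lt hle hym)).trans_le
        (SkorokhodSpace.occupationFraction_le_pathAverage_ramp γ ht hmy _)
    · exact (le_of_lt hω).trans
        (SkorokhodSpace.pathAverage_ramp_le_occupationFraction γ ht hmy _)
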